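/- Let $p$ be a prime, let $K$ be a field of characteristic $p$, and let $G$ be a finite cyclic group of order $q=p^{\alpha}$. Let $V_1,\dots,V_q$ represent the isomorphism classes of indecomposable $KG$-modules, with $\dim V_i=i$, and let $V_0=0$. For $0\le m\le n\le q$, the Jordan partition $\lambda(m,n,p)=(\lambda_1,\dots,\lambda_m)$ is given by $V_m\otimes V_n\cong V_{\lambda_1}\oplus\dots\oplus V_{\lambda_m}$ with $\lambda_1\ge\dots\ge\lambda_m>0$ (it is the empty partition for $m=0$). It is called standard if $\lambda_i=m+n-2i+1$ for $1\le i\le m$; in particular the empty partition is standard. Let $m,n$ be integers with $0<m\le n\le q$, let $k\ge 0$ be the integer with $p^k\le n<p^{k+1}$, and write $n=bp^k+d$ and $m=ap^k+c$ with $0<b<p$, $0\le a<p$, $0\le c,d<p^k$. Then: 1. If $m+n>p^{k+1}$, then $\lambda(m,n,p)$ is standard if and only if $m+n-p^{k+1}=1$ and $\lambda(p^{k+1}-n,\,p^{k+1}-m,\,p)$ is standard. 2. If $m+n\le p^{k+1}$ and $c+d>p^k$, then $\lambda(m,n,p)$ is standard if and only if $c+d-p^k=1$ and $\lambda((a+b+1)p^k-n,\,(a+b+1)p^k-m,\,p)$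 is standard. 3. If $m+n\le p^{k+1}$, $1\le c+d\le p^k$ and $a>0$, then $\lambda(m,n,p)$ is standard if and only if $\lambda(\min(c,d),\max(c,d),p)$ is standard, $|c-d|\le 1$, and $\lambda((a+b)p^k-n,\,(a+b)p^k-m,\,p)$ is standard. 4. If $m+n\le p^{k+1}$, $1\le c+d\le p^k$, $a=0$ and $d>0$, then $\lambda(m,n,p)$ is standard if and only if $\lambda(m,\,bp^k-d,\,p)$ is standard. 5. If $m+n\le p^{k+1}$, $1\le c+d\le p^k$, $a=0$ and $d=0$, then $\lambda(m,n,p)$ is standard if and only if $m=1$. 6. If $m+n\le p^{k+1}$ and $c=d=0$, then $\lambda(m,n,p)$ is standard if and only if $k=0$. -/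

import Mathlib

/-- A `KG`-module (a representation of `G` over `K`) is indecomposable if it is nonzero and is not
the direct sum of two nonzero submodules. -/
def IsIndecomposableRep {K G W : Type*} [Field K] [Group G] [AddCommGroup W] [Module K W]
    (σ : Representation K G W) : Prop :=
  Nontrivial W ∧ ∀ A B : Subrepresentation σ,
    IsCompl A.toSubmodule B.toSubmodule → A.toSubmodule = ⊥ ∨ B.toSubmodule = ⊥

/-- `V 1, …, V q` are indecomposable `KG`-modules with `dim (V i) = i`, and `V 0` is the zero
module. If `G` is cyclic of order `q`, a power of the characteristic of `K`, then there is exactly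
one indecomposable `KG`-module of each dimension `1, …, q` up to isomorphism and there are no
others, so `V 1, …, V q` represent all the isomorphism classes. -/
structure IsIndecomposableSystem {K G : Type*} [Field K] [Group G] {V : ℕ → Type*}
    [∀ i, AddCommGroup (V i)] [∀ i, Module K (V i)]
    (ρ : ∀ i, Representation K G (V i)) (q : ℕ) : Prop where
  finiteDimensional : ∀ i ≤ q, FiniteDimensional K (V i)
  finrank_eq : ∀ i ≤ q, Module.finrank K (V i) = i
  indecomposable : ∀ i, 1 ≤ i → i ≤ q → IsIndecomposableRep (ρ i)

/-- `l = (l 0, …, l (m - 1))` is the Jordan partition of `m * n`: it is nonincreasing with positive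
parts, and `V m ⊗ V n` (with the diagonal action) is isomorphic to the direct sum of the
indecomposable modules `V (l 0), …, V (l (m - 1))`. By the Krull–Schmidt theorem there is at most
one such `l`. For `m = 0` it is the empty partition. -/
def IsJordanPartition {K G : Type*} [Field K] [Group G] {V : ℕ → Type*}
    [∀ i, AddCommGroup (V i)] [∀ i, Module K (V i)]
    (ρ : ∀ i, Representation K G (V i)) (q m n : ℕ) (l : Fin m → ℕ) : Prop :=
  Antitone l ∧ (∀ i, 1 ≤ l i ∧ l i ≤ q) ∧
    Nonempty (((ρ m).tprod (ρ n)).Equiv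
      (Representation.directSum (fun i : Fin m => ρ (l i))))

/-- The Jordan partition `(l 0, …, l (m - 1))` of `m * n` is standard: its `i`-th part, counted
from `1`, is `m + n - 2 * i + 1`. -/
def IsStandardJordanPartition {K G : Type*} [Field K] [Group G] {V : ℕ → Type*}
    [∀ i, AddCommGroup (V i)] [∀ i, Module K (V i)]
    (ρ : ∀ i, Representation K G (V i)) (q m n : ℕ) : Prop :=
  ∃ l : Fin m → ℕ, IsJordanPartition ρ q m n l ∧
    ∀ i : Fin m, (l i : ℤ) = (m : ℤ) + n - 2 * ((i : ℤ) + 1) + 1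

/-!
Let `g` generate `G`. On `V m ⊗ V n` we have `g ⊗ g - 1 = X + Y` with `X = (g - 1) ⊗ 1` and
`Y = g ⊗ (g - 1)`; these commute, `X ^ m = Y ^ n = 0`, and the monomials `X ^ i Y ^ j` with `i < m`,
`j < n` applied to one vector form a basis. The Jordan partition is the Jordan type of `X + Y`, and
it is standard if and only if, for every `c ≤ m`, multiplication by `(X + Y) ^ (m + n - 2 c)` is
bijective from degree `c - 1` to the opposite degree `m + n - c - 1`. The determinant of that map is
a determinant of binomial coefficients, which MacMahon's formula evaluates as the number of plane
partitions in an `(m - c) × (n - c) × c` box. Its `p`-adic valuation is a sum over the powers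
`N = p ^ s` of terms that depend only on `m - c`, `n - c` and `c` modulo `N`. All of them vanish if
and only if, for each `N ≤ m`, the residues of `m` and `n` modulo `N` and those of `m` and `-n`
differ by at most `1`, and, for each `N > m`, a condition on `n` modulo `N` holds; the six cases
compare these conditions for different pairs.
-/

section Determinant

open Finset Matrix
open scoped Nat

/-- The matrix of binomial coefficients whose determinant, by MacMahon's formula, counts the plane
partitions in an `a × b × c` box. -/
def binomialMatrix (a b c : ℕ) : Matrix (Fin c) (Fin c) ℤ :=
  .of fun i s => ((a + b + i).choose (b + s) : ℤ)

/-- The product `0! 1! ⋯ (n - 1)!`, which is the Barnes `G`-function at `n + 1`. -/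
def factorialProd (n : ℕ) : ℕ := ∏ i ∈ range n, i !

theorem factorialProd_ne_zero (n : ℕ) : factorialProd n ≠ 0 :=
  prod_ne_zero_iff.2 fun i _ => i.factorial_ne_zero

theorem factorialProd_add (m n : ℕ) :
    factorialProd (m + n) = factorialProd m * ∏ i : Fin n, (m + i)! := by
  rw [factorialProd, prod_range_add, Fin.prod_univ_eq_prod_range (fun i => (m + i)!), factorialProd]

theorem det_descFactorial (a c : ℕ) :
    (Matrix.of fun i s : Fin c => ((a + i).descFactorial s : ℤ)).det = factorialProd c := by
  have h := det_eval_matrixOfPolynomials_eq_det_vandermonde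
    (fun i : Fin c => ((a + i : ℕ) : ℤ)) (fun s => descPochhammer ℤ s)
    (fun s => descPochhammer_natDegree ℤ s) (fun s => monic_descPochhammer ℤ s)
  simp only [descPochhammer_eval_eq_descFactorial] at h
  simp only [← h, Nat.cast_add, add_comm (a : ℤ), det_vandermonde_add]
  cases c with
  | zero => simp [factorialProd]
  | succ c =>
    rw [det_vandermonde_id_eq_superFactorial, ← Nat.prod_range_succ_factorial, factorialProd]

theorem choose_mul_factorial_mul_factorial_eq_mul_descFactorial (r b s : ℕ) :
    (b + r).choose (b + s) * (b + s)! * r ! = (b + r)! * r.descFactorial s := by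
  rcases le_or_gt s r with h | h
  · rw [← Nat.choose_mul_factorial_mul_factorial (Nat.add_le_add_left h b), Nat.add_sub_add_left,
      ← Nat.factorial_mul_descFactorial h]
    ring
  · rw [Nat.choose_eq_zero_of_lt (by omega), Nat.descFactorial_eq_zero_iff_lt.2 h]
    simp

/-- MacMahon's box formula. Scaling rows and columns by factorials turns `binomialMatrix` into a
matrix of descending factorials, whose determinant is a Vandermonde determinant. -/
theorem det_binomialMatrix_mul (a b c : ℕ) :
    (binomialMatrix a b c).det *
        (factorialProd (a + b) * factorialProd (a + c) * factorialProd (b + c)) =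
      factorialProd a * factorialProd b * factorialProd c * factorialProd (a + b + c) := by
  have key : diagonal (fun i : Fin c => ((a + i)! : ℤ)) * binomialMatrix a b c *
        diagonal (fun s : Fin c => ((b + s)! : ℤ)) =
      diagonal (fun i : Fin c => ((a + b + i)! : ℤ)) *
        Matrix.of fun i s : Fin c => ((a + i).descFactorial s : ℤ) := by
    ext i s
    have h := choose_mul_factorial_mul_factorial_eq_mul_descFactorial (a + i) b s
    rw [mul_comm, ← mul_assoc] at h
    simp only [mul_diagonal, diagonal_mul, binomialMatrix, of_apply, add_comm _ b,
      ← add_assoc] at h ⊢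
    exact_mod_cast h
  have hdet := congrArg det key
  simp only [det_mul, det_diagonal, det_descFactorial] at hdet
  simp only [factorialProd_add _ c, Nat.cast_mul, Nat.cast_prod]
  linear_combination
    (factorialProd a * factorialProd b * factorialProd (a + b) : ℤ) * hdet

/-- The sum `∑ i < n, ⌊i / N⌋`, the contribution of the prime power `N = p ^ s` to the `p`-adic
valuation of `factorialProd n`. -/
def divSum (N n : ℕ) : ℕ := ∑ i ∈ range n, i / N

theorem divSum_succ (N n : ℕ) : divSum N (n + 1) = divSum N n + n / N :=
  sum_range_succ _ _

theorem padicValNat_factorialProd {p : ℕ} [Fact p.Prime] {n B : ℕ} (hn : n ≤ p ^ B) :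
    padicValNat p (factorialProd n) = ∑ s ∈ Ico 1 B, divSum (p ^ s) n := by
  have hfact : ∀ i ∈ range n, padicValNat p i ! = ∑ s ∈ Ico 1 B, i / p ^ s := by
    intro i hi
    have hi' : i < p ^ B := (mem_range.1 hi).trans_le hn
    obtain rfl | hi0 := eq_or_ne i 0
    · simp
    · exact padicValNat_factorial (Nat.log_lt_of_lt_pow hi0 hi')
  simp only [divSum]
  rw [sum_comm, ← sum_congr rfl hfact]
  clear hfact hn
  induction n with
  | zero => simp [factorialProd]
  | succ n ih =>
    rw [factorialProd, prod_range_succ, ← factorialProd, sum_range_succ,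
      padicValNat.mul (factorialProd_ne_zero n) n.factorial_ne_zero, ih]

theorem divSum_add_self {N : ℕ} (hN : 0 < N) (n : ℕ) : divSum N (n + N) = divSum N n + n := by
  induction n with
  | zero =>
    rw [zero_add]
    exact sum_eq_zero fun i hi => Nat.div_eq_of_lt (mem_range.1 hi)
  | succ n ih =>
    rw [add_right_comm, divSum_succ, divSum_succ, ih, Nat.add_div_right _ hN]
    omega

theorem divSum_of_le_three_mul {N n : ℕ} (hn : n ≤ 3 * N) :
    divSum N n = (n - N) + (n - 2 * N) := by
  have hsmall : ∀ k ≤ N, divSum N k = 0 := fun k hk =>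
    sum_eq_zero fun i hi => Nat.div_eq_of_lt ((mem_range.1 hi).trans_le hk)
  rcases le_or_gt n N with h | h
  · rw [hsmall n h]
    omega
  obtain ⟨k, rfl⟩ := Nat.exists_eq_add_of_le' h.le
  rw [divSum_add_self (by omega)]
  rcases le_or_gt k N with h' | h'
  · rw [hsmall k h']
    omega
  · obtain ⟨j, rfl⟩ := Nat.exists_eq_add_of_le' h'.le
    rw [divSum_add_self (by omega), hsmall j (by omega)]
    omega

/-- The contribution of the prime power `N = p ^ s` to the `p`-adic valuation of the determinant
of `binomialMatrix a b c`. -/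
def boxExcess (N a b c : ℕ) : ℤ :=
  divSum N a + divSum N b + divSum N c + divSum N (a + b + c) -
    (divSum N (a + b) + divSum N (a + c) + divSum N (b + c))

theorem boxExcess_swap_left (N a b c : ℕ) : boxExcess N a b c = boxExcess N b a c := by
  simp only [boxExcess, add_comm b a]
  ring

theorem boxExcess_swap_right (N a b c : ℕ) : boxExcess N a b c = boxExcess N a c b := by
  simp only [boxExcess, add_comm c b, add_right_comm a c b]
  ring

theorem boxExcess_periodic {N : ℕ} (hN : 0 < N) (a b : ℕ) :
    Function.Periodic (boxExcess N a b) N := by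
  intro c
  simp only [boxExcess, ← add_assoc, divSum_add_self hN]
  push_cast
  ring

theorem boxExcess_mod {N : ℕ} (hN : 0 < N) (a b c : ℕ) :
    boxExcess N (a % N) (b % N) (c % N) = boxExcess N a b c := by
  have hmod := fun x y => (boxExcess_periodic hN x y).map_mod_nat
  rw [hmod, boxExcess_swap_right, hmod, boxExcess_swap_left, boxExcess_swap_right, hmod,
    boxExcess_swap_right, boxExcess_swap_left, boxExcess_swap_right]

theorem boxExcess_of_lt {N a b c : ℕ} (ha : a < N) (hb : b < N) (hc : c < N) :
    boxExcess N a b c = ((a + b + c - N + (a + b + c - 2 * N) : ℕ) : ℤ) -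
      ((a + b - N) + (a + c - N) + (b + c - N) : ℕ) := by
  rw [boxExcess, divSum_of_le_three_mul, divSum_of_le_three_mul, divSum_of_le_three_mul,
    divSum_of_le_three_mul, divSum_of_le_three_mul, divSum_of_le_three_mul,
    divSum_of_le_three_mul] <;> omega

theorem boxExcess_nonneg {N : ℕ} (hN : 0 < N) (a b c : ℕ) : 0 ≤ boxExcess N a b c := by
  have ha := Nat.mod_lt a hN
  have hb := Nat.mod_lt b hN
  have hc := Nat.mod_lt c hN
  rw [← boxExcess_mod hN, boxExcess_of_lt ha hb hc]
  omega

theorem boxExcess_eq_zero_iff {N : ℕ} (hN : 0 < N) (a b c : ℕ) :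
    boxExcess N a b c = 0 ↔ a % N = 0 ∨ b % N = 0 ∨ c % N = 0 ∨
      a % N + b % N + c % N ≤ N ∨ 2 * N ≤ a % N + b % N + c % N := by
  have ha := Nat.mod_lt a hN
  have hb := Nat.mod_lt b hN
  have hc := Nat.mod_lt c hN
  rw [← boxExcess_mod hN, boxExcess_of_lt ha hb hc]
  omega

theorem det_binomialMatrix_ne_zero (a b c : ℕ) : (binomialMatrix a b c).det ≠ 0 := by
  have h : (factorialProd a * factorialProd b * factorialProd c * factorialProd (a + b + c) : ℤ)
      ≠ 0 := by
    exact_mod_cast by simp [factorialProd_ne_zero]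
  exact left_ne_zero_of_mul (det_binomialMatrix_mul a b c ▸ h)

theorem padicValInt_det_binomialMatrix {p : ℕ} [Fact p.Prime] {a b c B : ℕ}
    (hB : a + b + c ≤ p ^ B) :
    (padicValInt p (binomialMatrix a b c).det : ℤ) =
      ∑ s ∈ Ico 1 B, boxExcess (p ^ s) a b c := by
  have hne : ∀ n, (factorialProd n : ℤ) ≠ 0 := fun n => Nat.cast_ne_zero.2 (factorialProd_ne_zero n)
  have hval : ∀ n ≤ a + b + c, (padicValInt p (factorialProd n) : ℤ) =
      ∑ s ∈ Ico 1 B, (divSum (p ^ s) n : ℤ) := fun n hn => by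
    rw [padicValInt.of_nat, padicValNat_factorialProd (hn.trans hB), Nat.cast_sum]
  have h := congrArg (fun z => (padicValInt p z : ℤ)) (det_binomialMatrix_mul a b c)
  simp only [padicValInt.mul, det_binomialMatrix_ne_zero a b c, hne, mul_eq_zero, or_self,
    ne_eq, not_false_eq_true, Nat.cast_add] at h
  rw [hval _ (by omega), hval _ (by omega), hval _ (by omega), hval _ (by omega),
    hval _ (by omega), hval _ (by omega), hval _ (by omega)] at h
  simp only [boxExcess, sum_sub_distrib, sum_add_distrib]
  linear_combination h

theorem not_dvd_det_binomialMatrix_iff {p : ℕ} [hp : Fact p.Prime] {a b c : ℕ} :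
    ¬ (p : ℤ) ∣ (binomialMatrix a b c).det ↔ ∀ s, 1 ≤ s → boxExcess (p ^ s) a b c = 0 := by
  have hpos : ∀ s, 0 < p ^ s := fun s => pow_pos hp.out.pos s
  have hsum : ∀ B, a + b + c ≤ B → (¬ (p : ℤ) ∣ (binomialMatrix a b c).det ↔
      ∀ s ∈ Ico 1 B, boxExcess (p ^ s) a b c = 0) := by
    intro B hB
    rw [← sum_eq_zero_iff_of_nonneg fun s _ => boxExcess_nonneg (hpos s) a b c,
      ← padicValInt_det_binomialMatrix (hB.trans (Nat.lt_pow_self hp.out.one_lt).le),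
      Nat.cast_eq_zero, padicValInt.eq_zero_iff]
    have hone := hp.out.ne_one
    have hdet := det_binomialMatrix_ne_zero a b c
    tauto
  refine ⟨fun h s hs => ?_, fun h => ?_⟩
  · exact (hsum _ (Nat.le_add_right _ (s + 1))).1 h s (mem_Ico.2 ⟨hs, by omega⟩)
  · exact (hsum _ le_rfl).2 fun s hs => h s (mem_Ico.1 hs).1

end Determinant

section Arithmetic

theorem sub_mod_eq_ite {N m c : ℕ} (hN : 0 < N) (hc : c ≤ m) :
    (m - c) % N = if c % N ≤ m % N then m % N - c % N else N + m % N - c % N := by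
  have hM := Nat.mod_lt m hN
  have hC := Nat.mod_lt c hN
  have hX := Nat.mod_lt (m - c) hN
  have hadd := Nat.add_mod_eq_ite (m := m - c) (n := c) (k := N)
  rw [Nat.sub_add_cancel hc] at hadd
  split_ifs at hadd ⊢ <;> omega

/-- The residues of `m` and `n` modulo `N` differ by at most `1`, and so do those of `m` and
`-n`, the latter taken between `1` and `N`. -/
def ResiduesBalanced (N m n : ℕ) : Prop :=
  m % N ≤ n % N + 1 ∧ n % N ≤ m % N + 1 ∧ m % N + n % N ≤ N + 1 ∧ N ≤ m % N + n % N + 1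

/-- The condition that the power `N` of the prime `p` imposes on `m ≤ n` for the Jordan partition
of `m * n` to be standard. -/
def IsStandardAt (N m n : ℕ) : Prop :=
  (N ≤ m → ResiduesBalanced N m n) ∧ (m < N → m ≤ n % N + 1 ∧ m + n % N ≤ N + 1)

variable {N m n : ℕ}

theorem ResiduesBalanced.symm (h : ResiduesBalanced N m n) : ResiduesBalanced N n m := by
  unfold ResiduesBalanced at *
  omega

theorem residuesBalanced_min_max : ResiduesBalanced N (min m n) (max m n) ↔
    ResiduesBalanced N m n := by
  rcases le_total m n with h | h
  · rw [min_eq_left h, max_eq_right h]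
  · rw [min_eq_right h, max_eq_left h]
    exact ⟨.symm, .symm⟩

theorem ResiduesBalanced.isStandardAt (h : ResiduesBalanced N m n) : IsStandardAt N m n := by
  refine ⟨fun _ => h, fun hm => ?_⟩
  rw [ResiduesBalanced, Nat.mod_eq_of_lt hm] at h
  exact ⟨h.1, h.2.2.1⟩

theorem residuesBalanced_of_isStandardAt (hN : 2 ≤ N) (hmn : m ≤ n) (hnm : n ≤ m + 1)
    (hsum : 2 * N ≤ m + n + 1) (h : IsStandardAt N m n) : ResiduesBalanced N m n := by
  rcases le_or_gt N m with hm | hm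
  · exact h.1 hm
  · obtain rfl : n = N := by omega
    have hle := (h.2 hm).1
    rw [Nat.mod_self] at hle
    obtain ⟨rfl, rfl⟩ : m = 1 ∧ n = 2 := by omega
    simp [ResiduesBalanced]

theorem isStandardAt_iff_of_lt (hmn : m ≤ n) (hn : n < N) : IsStandardAt N m n ↔ m + n ≤ N + 1 := by
  rw [IsStandardAt, Nat.mod_eq_of_lt hn]
  omega

theorem residuesBalanced_sub_iff {R : ℕ} (hN : 0 < N) (hR : N ∣ R) (hm : m ≤ R) (hn : n ≤ R) :
    ResiduesBalanced N (R - n) (R - m) ↔ ResiduesBalanced N m n := by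
  have hM := Nat.mod_lt m hN
  have hD := Nat.mod_lt n hN
  simp only [ResiduesBalanced, sub_mod_eq_ite hN hm, sub_mod_eq_ite hN hn,
    Nat.mod_eq_zero_of_dvd hR]
  split_ifs <;> omega

theorem le_mod_add_mod_add_one_of_isStandardAt_sub_sub {R : ℕ} (hN : 0 < N) (hR : N ∣ R)
    (hm : m ≤ R) (hn : n < R) (h : IsStandardAt N (R - n) (R - m)) : N ≤ m % N + n % N + 1 := by
  rcases le_or_gt N (R - n) with hlt | hlt
  · exact ((residuesBalanced_sub_iff hN hR hm hn.le).1 (h.1 hlt)).2.2.2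
  · have hstd := h.2 hlt
    have hRn := sub_mod_eq_ite hN hn.le
    rw [Nat.mod_eq_of_lt hlt] at hRn
    rw [sub_mod_eq_ite hN hm] at hstd
    rw [Nat.mod_eq_zero_of_dvd hR] at hRn hstd
    have hM := Nat.mod_lt m hN
    split_ifs at hRn hstd <;> omega

theorem isStandardAt_sub_right_iff {R : ℕ} (hN : 0 < N) (hR : N ∣ R) (hn : n ≤ R) :
    IsStandardAt N m (R - n) ↔ IsStandardAt N m n := by
  have hM := Nat.mod_lt m hN
  have hD := Nat.mod_lt n hN
  simp only [IsStandardAt, ResiduesBalanced, sub_mod_eq_ite hN hn, Nat.mod_eq_zero_of_dvd hR]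
  split_ifs <;> omega

theorem isStandardAt_sub_sub_iff {R : ℕ} (hN : 2 ≤ N) (hR : N ∣ R) (hm : 1 ≤ m) (hn : 1 ≤ n)
    (h : m + n = R + 1) : IsStandardAt N (R - n) (R - m) ↔ IsStandardAt N m n := by
  have hN0 : 0 < N := by omega
  have hM := Nat.mod_lt m hN0
  have hD := Nat.mod_lt n hN0
  have hadd := Nat.add_mod_eq_ite (m := m) (n := n) (k := N)
  rw [h, Nat.add_mod, Nat.mod_eq_zero_of_dvd hR, zero_add, Nat.mod_mod,
    Nat.mod_eq_of_lt (by omega : 1 < N)] at hadd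
  rw [show R - n = m - 1 by omega, show R - m = n - 1 by omega]
  have hm1 := sub_mod_eq_ite hN0 hm
  have hn1 := sub_mod_eq_ite hN0 hn
  rw [Nat.mod_eq_of_lt (by omega : 1 < N)] at hm1 hn1
  have hlt := fun hlt : m < N => Nat.mod_eq_of_lt hlt
  simp only [IsStandardAt, ResiduesBalanced]
  have hmN : m = N → m % N = 0 := by rintro rfl; exact Nat.mod_self m
  split_ifs at hadd hm1 hn1 <;> omega

theorem boxExcess_sub_eq_zero_iff {c : ℕ} (hN : 0 < N) (hcm : c ≤ m) (hcn : c ≤ n) :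
    boxExcess N (m - c) (n - c) c = 0 ↔ c % N = 0 ∨
      (c % N < m % N → c % N < n % N → m % N + n % N ≤ N + c % N) ∧
      (c % N < m % N → n % N < c % N → N + c % N ≤ m % N + n % N) ∧
      (m % N < c % N → c % N < n % N → N + c % N ≤ m % N + n % N) ∧
      (m % N < c % N → n % N < c % N → c % N ≤ m % N + n % N) := by
  have hM := Nat.mod_lt m hN
  have hD := Nat.mod_lt n hN
  have hC := Nat.mod_lt c hN
  rw [boxExcess_eq_zero_iff hN, sub_mod_eq_ite hN hcm, sub_mod_eq_ite hN hcn]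
  split_ifs <;> omega

theorem isStandardAt_of_forall_boxExcess_sub_eq_zero (hN : 2 ≤ N) (hmn : m ≤ n)
    (h : ∀ c ≤ m, boxExcess N (m - c) (n - c) c = 0) : IsStandardAt N m n := by
  have hN0 : 0 < N := by omega
  have hM := Nat.mod_lt m hN0
  have hD := Nat.mod_lt n hN0
  have hz : ∀ z, z ≠ 0 → z ≤ m → z < N →
    (z < m % N → z < n % N → m % N + n % N ≤ N + z) ∧
    (z < m % N → n % N < z → N + z ≤ m % N + n % N) ∧
    (m % N < z → z < n % N → N + z ≤ m % N + n % N) ∧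
    (m % N < z → n % N < z → z ≤ m % N + n % N) := by
    intro z hz0 hzm hzN
    have := (boxExcess_sub_eq_zero_iff hN0 hzm (hzm.trans hmn)).1 (h z hzm)
    rw [Nat.mod_eq_of_lt hzN] at this
    exact this.resolve_left hz0
  refine ⟨fun hm => ⟨?_, ?_, ?_, ?_⟩, fun hm => ?_⟩
  · by_contra! hgt
    have := (hz (n % N + 1) (by omega) (by omega) (by omega)).2.1 (by omega) (by omega)
    omega
  · by_contra! hgt
    have := (hz (m % N + 1) (by omega) (by omega) (by omega)).2.2.1 (by omega) (by omega)
    omega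
  · by_contra! hgt
    have := (hz 1 (by omega) (by omega) (by omega)).1 (by omega) (by omega)
    omega
  · by_contra! hgt
    have := (hz (N - 1) (by omega) (by omega) (by omega)).2.2.2 (by omega) (by omega)
    omega
  · rw [Nat.mod_eq_of_lt hm] at hz
    constructor
    · by_contra! hgt
      have := (hz (n % N + 1) (by omega) (by omega) (by omega)).2.1 (by omega) (by omega)
      omega
    · by_contra! hgt
      have := (hz 1 (by omega) (by omega) (by omega)).1 (by omega) (by omega)
      omega

theorem boxExcess_sub_eq_zero_of_isStandardAt (hN : 0 < N) {c : ℕ} (hcm : c ≤ m) (hmn : m ≤ n)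
    (h : IsStandardAt N m n) : boxExcess N (m - c) (n - c) c = 0 := by
  rw [boxExcess_sub_eq_zero_iff hN hcm (hcm.trans hmn)]
  have := Nat.mod_lt m hN
  have := Nat.mod_lt n hN
  have hC := Nat.mod_lt c hN
  rcases le_or_gt N m with hm | hm
  · have := h.1 hm
    unfold ResiduesBalanced at this
    omega
  · have := h.2 hm
    rw [Nat.mod_eq_of_lt hm, Nat.mod_eq_of_lt (hcm.trans_lt hm)]
    omega

/-- The numerical criterion for the Jordan partition of `m * n` to be standard in
characteristic `p`. -/
def IsStandardPair (p m n : ℕ) : Prop := ∀ s, 1 ≤ s → IsStandardAt (p ^ s) m n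

variable {p : ℕ}

theorem two_le_pow (hp : 2 ≤ p) {s : ℕ} (hs : 1 ≤ s) : 2 ≤ p ^ s :=
  hp.trans (Nat.le_self_pow (by omega) p)

theorem forall_not_dvd_det_binomialMatrix_iff [hp : Fact p.Prime] (hmn : m ≤ n) :
    (∀ c ≤ m, ¬ (p : ℤ) ∣ (binomialMatrix (m - c) (n - c) c).det) ↔ IsStandardPair p m n := by
  simp only [not_dvd_det_binomialMatrix_iff]
  exact ⟨fun h s hs => isStandardAt_of_forall_boxExcess_sub_eq_zero
      (two_le_pow hp.out.two_le hs) hmn fun c hc => h c hc s hs,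
    fun h c hc s hs => boxExcess_sub_eq_zero_of_isStandardAt
      (pow_pos hp.out.pos s) hc hmn (h s hs)⟩

theorem isStandardPair_iff_forall_lt (hp : 2 ≤ p) {K : ℕ} (hmn : m ≤ n) (hn : n < p ^ K)
    (h : m + n ≤ p ^ K + 1) :
    IsStandardPair p m n ↔ ∀ s, 1 ≤ s → s < K → IsStandardAt (p ^ s) m n := by
  refine forall₂_congr fun s _ => ⟨fun hat _ => hat, fun hlt => ?_⟩
  rcases lt_or_ge s K with hsK | hsK
  · exact hlt hsK
  · have hpow : p ^ K ≤ p ^ s := Nat.pow_le_pow_right (by omega) hsK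
    exact (isStandardAt_iff_of_lt hmn (by omega)).2 (by omega)

variable {k : ℕ}

theorem isStandardPair_sub_sub_iff (hp : 2 ≤ p) {R : ℕ} (hR : p ^ k ∣ R) (hR' : R ≤ p ^ (k + 1))
    (hm : 1 ≤ m) (hmn : m ≤ n) (hn : n < p ^ (k + 1)) (h : m + n = R + 1) :
    IsStandardPair p (R - n) (R - m) ↔ IsStandardPair p m n := by
  rw [isStandardPair_iff_forall_lt hp (by omega) (by omega : R - m < p ^ (k + 1)) (by omega),
    isStandardPair_iff_forall_lt hp hmn hn (by omega)]
  exact forall₃_congr fun s hs hsk => isStandardAt_sub_sub_iff (two_le_pow hp hs)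
    ((pow_dvd_pow p (by omega)).trans hR) hm (hm.trans hmn) h

theorem isStandardPair_iff_of_gt (hp : 2 ≤ p) (hm : 1 ≤ m) (hmn : m ≤ n) (hn : n < p ^ (k + 1))
    (h : p ^ (k + 1) < m + n) :
    IsStandardPair p m n ↔
      m + n - p ^ (k + 1) = 1 ∧ IsStandardPair p (p ^ (k + 1) - n) (p ^ (k + 1) - m) := by
  have hdual : m + n - p ^ (k + 1) = 1 →
      (IsStandardPair p (p ^ (k + 1) - n) (p ^ (k + 1) - m) ↔ IsStandardPair p m n) := fun h1 =>
    isStandardPair_sub_sub_iff hp (pow_dvd_pow p (Nat.le_succ k)) le_rfl hm hmn hn (by omega)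
  rw [and_congr_right hdual, iff_and_self]
  intro hs
  have := (isStandardAt_iff_of_lt hmn hn).1 (hs (k + 1) (by omega))
  omega

theorem mul_pow_add_mod_pow {s : ℕ} (hs : s ≤ k) (a c : ℕ) :
    (a * p ^ k + c) % p ^ s = c % p ^ s := by
  rw [Nat.add_mod, Nat.mod_eq_zero_of_dvd ((pow_dvd_pow p hs).mul_left a), zero_add, Nat.mod_mod]

variable {a b c d : ℕ}

theorem mul_pow_add_lt_pow_succ (hb : b < p) (hd : d < p ^ k) : b * p ^ k + d < p ^ (k + 1) :=
  calc b * p ^ k + d < (b + 1) * p ^ k := by rw [add_one_mul]; exact Nat.add_lt_add_left hd _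
    _ ≤ p ^ (k + 1) := by rw [pow_succ']; exact Nat.mul_le_mul_right _ hb

theorem isStandardPair_iff_of_residues_gt (hp : 2 ≤ p) (hc : c < p ^ k) (hd : d < p ^ k)
    (hmn : a * p ^ k + c ≤ b * p ^ k + d) (hn : b * p ^ k + d < p ^ (k + 1))
    (hle : a * p ^ k + c + (b * p ^ k + d) ≤ p ^ (k + 1)) (h : p ^ k < c + d) :
    IsStandardPair p (a * p ^ k + c) (b * p ^ k + d) ↔ c + d - p ^ k = 1 ∧
      IsStandardPair p ((a + b + 1) * p ^ k - (b * p ^ k + d))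
        ((a + b + 1) * p ^ k - (a * p ^ k + c)) := by
  have hR : (a + b + 1) * p ^ k = a * p ^ k + b * p ^ k + p ^ k := by ring
  have hk : k ≠ 0 := by
    rintro rfl
    rw [pow_zero] at hc hd h
    omega
  rw [and_congr_right fun h1 => isStandardPair_sub_sub_iff hp (Dvd.intro_left _ rfl) (by omega)
    (by omega) hmn hn (by omega), iff_and_self]
  intro hs
  have hat := hs k (by omega)
  rw [IsStandardAt, ResiduesBalanced, mul_pow_add_mod_pow le_rfl, mul_pow_add_mod_pow le_rfl,
    Nat.mod_eq_of_lt hc, Nat.mod_eq_of_lt hd] at hat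
  omega

theorem residuesBalanced_mul_pow_add_iff {s : ℕ} (hs : s ≤ k) :
    ResiduesBalanced (p ^ s) (a * p ^ k + c) (b * p ^ k + d) ↔ ResiduesBalanced (p ^ s) c d := by
  simp only [ResiduesBalanced, mul_pow_add_mod_pow hs]

theorem isStandardPair_iff_forall_residuesBalanced (hp : 2 ≤ p) (ha : 0 < a)
    (hmn : a * p ^ k + c ≤ b * p ^ k + d) (hn : b * p ^ k + d < p ^ (k + 1))
    (hle : a * p ^ k + c + (b * p ^ k + d) ≤ p ^ (k + 1)) :
    IsStandardPair p (a * p ^ k + c) (b * p ^ k + d) ↔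
      ∀ s, 1 ≤ s → s < k + 1 → ResiduesBalanced (p ^ s) c d := by
  rw [isStandardPair_iff_forall_lt hp hmn hn (by omega)]
  refine forall₃_congr fun s _ hsk => ?_
  have hka : p ^ k ≤ a * p ^ k := Nat.le_mul_of_pos_left _ ha
  have hks : p ^ s ≤ p ^ k := Nat.pow_le_pow_right (by omega) (by omega)
  rw [← residuesBalanced_mul_pow_add_iff (Nat.le_of_lt_succ hsk)]
  exact ⟨fun h => h.1 (by omega), ResiduesBalanced.isStandardAt⟩

theorem isStandardPair_min_max_of_forall_residuesBalanced (hp : 2 ≤ p) (hc : c < p ^ k)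
    (hd : d < p ^ k) (h2 : c + d ≤ p ^ k)
    (h : ∀ s, 1 ≤ s → s < k + 1 → ResiduesBalanced (p ^ s) c d) :
    IsStandardPair p (min c d) (max c d) :=
  (isStandardPair_iff_forall_lt hp (by omega) (by omega : max c d < p ^ k) (by omega)).2
    fun s hs hsk => (residuesBalanced_min_max.2 (h s hs (by omega))).isStandardAt

theorem isStandardPair_sub_sub_of_forall_residuesBalanced (hp : 2 ≤ p) (hd : d ≤ a * p ^ k)
    (hmn : a * p ^ k + c ≤ b * p ^ k + d) (hn : b * p ^ k + d < p ^ (k + 1))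
    (hle : a * p ^ k + c + (b * p ^ k + d) ≤ p ^ (k + 1))
    (h : ∀ s, 1 ≤ s → s < k + 1 → ResiduesBalanced (p ^ s) c d) :
    IsStandardPair p ((a + b) * p ^ k - (b * p ^ k + d)) ((a + b) * p ^ k - (a * p ^ k + c)) := by
  have hR : (a + b) * p ^ k = a * p ^ k + b * p ^ k := add_mul a b _
  rw [isStandardPair_iff_forall_lt hp (by omega) (by omega : _ < p ^ (k + 1)) (by omega)]
  intro s hs hsk
  have hdvd : p ^ s ∣ (a + b) * p ^ k := (pow_dvd_pow p (Nat.le_of_lt_succ hsk)).mul_left _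
  exact ((residuesBalanced_sub_iff (pow_pos (by omega) s) hdvd (by omega) (by omega)).2
    ((residuesBalanced_mul_pow_add_iff (Nat.le_of_lt_succ hsk)).2 (h s hs hsk))).isStandardAt

theorem residuesBalanced_of_isStandardPair_min_max (hp : 2 ≤ p) (hc : c < p ^ k) (hd : d < p ^ k)
    (hcd : c ≤ d + 1) (hdc : d ≤ c + 1) (hle : c + d ≤ p ^ k) (hge : p ^ k ≤ c + d + 1)
    (h : IsStandardPair p (min c d) (max c d)) {s : ℕ} (hs : 1 ≤ s) (hsk : s < k + 1) :
    ResiduesBalanced (p ^ s) c d := by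
  obtain rfl | hsk := (Nat.le_of_lt_succ hsk).eq_or_lt
  · rw [ResiduesBalanced, Nat.mod_eq_of_lt hc, Nat.mod_eq_of_lt hd]
    omega
  · have hpow : 2 * p ^ s ≤ p ^ k :=
      (Nat.mul_le_mul_right _ hp).trans (pow_succ' p s ▸ Nat.pow_le_pow_right (by omega) hsk)
    exact residuesBalanced_min_max.1 (residuesBalanced_of_isStandardAt (two_le_pow hp hs)
      (by omega) (by omega) (by omega) (h s hs))

theorem isStandardPair_iff_of_residues_le (hp : 2 ≤ p) (ha : 0 < a) (hc : c < p ^ k)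
    (hd : d < p ^ k) (hmn : a * p ^ k + c ≤ b * p ^ k + d) (hn : b * p ^ k + d < p ^ (k + 1))
    (hle : a * p ^ k + c + (b * p ^ k + d) ≤ p ^ (k + 1)) (h1 : 1 ≤ c + d) (h2 : c + d ≤ p ^ k) :
    IsStandardPair p (a * p ^ k + c) (b * p ^ k + d) ↔
      IsStandardPair p (min c d) (max c d) ∧ |(c : ℤ) - (d : ℤ)| ≤ 1 ∧
        IsStandardPair p ((a + b) * p ^ k - (b * p ^ k + d))
          ((a + b) * p ^ k - (a * p ^ k + c)) := by
  have hk : 1 ≤ k := by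
    by_contra! hk
    obtain rfl : k = 0 := by omega
    rw [pow_zero] at hc hd
    omega
  have hka : p ^ k ≤ a * p ^ k := Nat.le_mul_of_pos_left _ ha
  rw [isStandardPair_iff_forall_residuesBalanced hp ha hmn hn hle, abs_le]
  refine ⟨fun h => ⟨isStandardPair_min_max_of_forall_residuesBalanced hp hc hd h2 h, ?_,
    isStandardPair_sub_sub_of_forall_residuesBalanced hp (by omega) hmn hn hle h⟩, ?_⟩
  · have hbal := h k hk k.lt_succ_self
    rw [ResiduesBalanced, Nat.mod_eq_of_lt hc, Nat.mod_eq_of_lt hd] at hbal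
    omega
  · rintro ⟨hmin, hdiff, hdual⟩ s hs hsk
    have hR : (a + b) * p ^ k = a * p ^ k + b * p ^ k := add_mul a b _
    have hge := le_mod_add_mod_add_one_of_isStandardAt_sub_sub (pow_pos (by omega) k)
      (Dvd.intro_left _ rfl) (by omega) (by omega) (hdual k hk)
    rw [mul_pow_add_mod_pow le_rfl, mul_pow_add_mod_pow le_rfl, Nat.mod_eq_of_lt hc,
      Nat.mod_eq_of_lt hd] at hge
    exact residuesBalanced_of_isStandardPair_min_max hp hc hd (by omega) (by omega) h2 hge hmin
      hs hsk

theorem isStandardPair_mul_pow_sub_iff (hp : 2 ≤ p) (hb : 0 < b) (hd : d < p ^ k)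
    (hn : b * p ^ k + d < p ^ (k + 1)) (h2 : c + d ≤ p ^ k) :
    IsStandardPair p c (b * p ^ k - d) ↔ IsStandardPair p c (b * p ^ k + d) := by
  have hkb : p ^ k ≤ b * p ^ k := Nat.le_mul_of_pos_left _ hb
  have hbp : (b + 1) * p ^ k ≤ p ^ (k + 1) := by
    rw [pow_succ'] at hn ⊢
    exact Nat.mul_le_mul_right _ (lt_of_mul_lt_mul_right (by omega : b * p ^ k < p * p ^ k)
      (Nat.zero_le _))
  rw [add_one_mul] at hbp
  rw [isStandardPair_iff_forall_lt hp (by omega) (by omega : _ - d < p ^ (k + 1)) (by omega),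
    isStandardPair_iff_forall_lt hp (by omega) hn (by omega)]
  refine forall₃_congr fun s _ hsk => ?_
  have hdvd : p ^ s ∣ 2 * b * p ^ k := (pow_dvd_pow p (Nat.le_of_lt_succ hsk)).mul_left _
  have hR : 2 * b * p ^ k = b * p ^ k + b * p ^ k := by ring
  rw [← isStandardAt_sub_right_iff (pow_pos (by omega) s) hdvd (by omega),
    show 2 * b * p ^ k - (b * p ^ k - d) = b * p ^ k + d by omega]

theorem isStandardPair_one_left (hp : 2 ≤ p) (n : ℕ) : IsStandardPair p 1 n := by
  intro s hs
  have hN := two_le_pow hp hs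
  have hD := Nat.mod_lt n (by omega : 0 < p ^ s)
  exact ⟨fun h => by omega, fun _ => ⟨Nat.le_add_left _ _, by omega⟩⟩

theorem isStandardPair_mul_pow_iff (hp : 2 ≤ p) (hc : c < p ^ k) (h1 : 1 ≤ c) :
    IsStandardPair p c (b * p ^ k) ↔ c = 1 := by
  refine ⟨fun h => ?_, by rintro rfl; exact isStandardPair_one_left hp _⟩
  have hk : 1 ≤ k := by
    by_contra! hk
    obtain rfl : k = 0 := by omega
    rw [pow_zero] at hc
    omega
  have hat := (h k hk).2 hc
  rw [Nat.mul_mod_left] at hat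
  omega

theorem isStandardPair_mul_pow_mul_pow_iff (hp : 2 ≤ p) (ha : 0 < a) (hab : a ≤ b)
    (hle : a * p ^ k + b * p ^ k ≤ p ^ (k + 1)) :
    IsStandardPair p (a * p ^ k) (b * p ^ k) ↔ k = 0 := by
  constructor
  · intro h
    by_contra hk
    have hN := two_le_pow hp (Nat.one_le_iff_ne_zero.2 hk)
    have hbal := (h k (by omega)).1 (Nat.le_mul_of_pos_left _ ha)
    rw [ResiduesBalanced, Nat.mul_mod_left, Nat.mul_mod_left] at hbal
    omega
  · rintro rfl
    simp only [pow_zero, mul_one, zero_add, pow_one] at hle ⊢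
    rw [isStandardPair_iff_forall_lt (K := 1) hp hab (by rw [pow_one]; omega)
      (by rw [pow_one]; omega)]
    exact fun s hs hs' => absurd hs (by omega)

end Arithmetic

section JordanType

open Module
open scoped DirectSum

variable {K W W' : Type*} [Field K] [AddCommGroup W] [Module K W] [AddCommGroup W'] [Module K W']
  {ι : Type*}

/-- The endomorphism `N` is nilpotent with Jordan blocks of sizes `l i`: there is a basis made of
the chains `w i, N (w i), …, N ^ (l i - 1) (w i)`. -/
def HasJordanType (N : End K W) (l : ι → ℕ) : Prop :=
  ∃ (b : Basis (Σ i, Fin (l i)) K W) (w : ι → W),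
    (∀ i, (N ^ l i) (w i) = 0) ∧ ∀ x, b x = (N ^ (x.2 : ℕ)) (w x.1)

theorem pow_apply_eq_zero_of_le {N : End K W} {v : W} {d r : ℕ} (hv : (N ^ d) v = 0)
    (hr : d ≤ r) : (N ^ r) v = 0 := by
  rw [← Nat.sub_add_cancel hr, pow_add, End.mul_apply, hv, map_zero]

theorem coeff_eq_zero_of_sum_chains_eq_zero [Fintype ι] {N : End K W} {l : ι → ℕ} {w : ι → W}
    (hw : ∀ i, (N ^ l i) (w i) = 0) (hlast : LinearIndependent K fun i => (N ^ (l i - 1)) (w i))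
    {g : (Σ i, Fin (l i)) → K} (hg : ∑ x, g x • (N ^ (x.2 : ℕ)) (w x.1) = 0) {E : ℕ}
    (hE : ∀ x : Σ i, Fin (l i), x.2 + E + 1 < l x.1 → g x = 0)
    (x : Σ i, Fin (l i)) (hx : x.2 + E + 1 = l x.1) : g x = 0 := by
  have hterm : ∀ x : Σ i, Fin (l i), (N ^ E) (g x • (N ^ (x.2 : ℕ)) (w x.1)) =
      (if x.2 + E + 1 = l x.1 then g x else 0) • (N ^ (l x.1 - 1)) (w x.1) := by
    intro x
    rw [map_smul, ← End.mul_apply, ← pow_add]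
    rcases lt_trichotomy (x.2 + E + 1) (l x.1) with h | h | h
    · rw [hE x h, if_neg h.ne, zero_smul, zero_smul]
    · rw [if_pos h, show E + x.2 = l x.1 - 1 by omega]
    · rw [pow_apply_eq_zero_of_le (hw x.1) (by omega), if_neg h.ne', smul_zero, zero_smul]
  have hsum := congrArg (N ^ E) hg
  simp only [map_sum, map_zero, hterm, Fintype.sum_sigma, ← Finset.sum_smul] at hsum
  have hcoeff := Fintype.linearIndependent_iff.1 hlast _ hsum x.1
  rwa [Finset.sum_eq_single x.2 (fun t _ ht => if_neg fun h => ht (Fin.ext (by omega)))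
    (by simp), if_pos hx] at hcoeff

theorem linearIndependent_chains [Finite ι] {N : End K W} {l : ι → ℕ} {w : ι → W}
    (hw : ∀ i, (N ^ l i) (w i) = 0) (hlast : LinearIndependent K fun i => (N ^ (l i - 1)) (w i)) :
    LinearIndependent K fun x : Σ i, Fin (l i) => (N ^ (x.2 : ℕ)) (w x.1) := by
  cases nonempty_fintype ι
  rw [Fintype.linearIndependent_iff]
  intro g hg
  have hdepth : ∀ E, ∀ x : Σ i, Fin (l i), x.2 + E < l x.1 → g x = 0 := by
    intro E
    refine Nat.decreasingInduction (n := E + ∑ i, l i)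
      (motive := fun E _ => ∀ x : Σ i, Fin (l i), x.2 + E < l x.1 → g x = 0)
      (fun E _ ih x hx => ?_) (fun x hx => ?_) (Nat.le_add_right _ _)
    · rcases (Nat.succ_le_of_lt hx).eq_or_lt with h | h
      · exact coeff_eq_zero_of_sum_chains_eq_zero hw hlast hg ih x h
      · exact ih x h
    · have hle := Finset.single_le_sum (f := l) (fun i _ => Nat.zero_le _) (Finset.mem_univ x.1)
      omega
  exact fun x => hdepth 0 x x.2.2

theorem hasJordanType_of_linearIndependent [Fintype ι] [FiniteDimensional K W] {N : End K W}
    {l : ι → ℕ} {w : ι → W} (hw : ∀ i, (N ^ l i) (w i) = 0)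
    (hlast : LinearIndependent K fun i => (N ^ (l i - 1)) (w i))
    (hcard : ∑ i, l i = finrank K W) : HasJordanType N l :=
  ⟨basisOfLinearIndependentOfCardEqFinrank' _ (linearIndependent_chains hw hlast) (by simp [hcard]),
    w, hw, fun x => by simp⟩

theorem HasJordanType.congr {N : End K W} {N' : End K W'} {l : ι → ℕ} (h : HasJordanType N l)
    (e : W ≃ₗ[K] W') (he : ∀ v, N' (e v) = e (N v)) : HasJordanType N' l := by
  obtain ⟨b, w, hw, hb⟩ := h
  have hpow (r : ℕ) (v : W) : (N' ^ r) (e v) = e ((N ^ r) v) :=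
    LinearMap.congr_fun (End.commute_pow_left_of_commute (f := e.toLinearMap)
      (LinearMap.ext he) r) v
  exact ⟨b.map e, e ∘ w, fun i => by simp [hpow, hw], fun x => by simp [hpow, hb]⟩

theorem HasJordanType.exists_linearEquiv {N : End K W} {N' : End K W'} {l : ι → ℕ}
    (h : HasJordanType N l) (h' : HasJordanType N' l) :
    ∃ e : W ≃ₗ[K] W', ∀ v, N' (e v) = e (N v) := by
  obtain ⟨b, w, hw, hb⟩ := h
  obtain ⟨b', w', hw', hb'⟩ := h'
  let e := b.equiv b' (.refl _)
  have he (i : ι) (t : ℕ) (ht : t < l i) : e ((N ^ t) (w i)) = (N' ^ t) (w' i) := by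
    simpa only [e, hb, hb', Equiv.refl_apply] using b.equiv_apply ⟨i, t, ht⟩ b' (.refl _)
  refine ⟨e, LinearMap.congr_fun (b.ext fun x => ?_ :
    N' ∘ₗ e.toLinearMap = e.toLinearMap ∘ₗ N)⟩
  simp only [LinearMap.comp_apply, LinearEquiv.coe_coe, hb, he _ _ x.2.2]
  rw [← End.mul_apply, ← End.mul_apply, ← pow_succ', ← pow_succ']
  rcases (Nat.succ_le_of_lt x.2.2).eq_or_lt with hx | hx
  · rw [← Nat.succ_eq_add_one, hx, hw, hw', map_zero]
  · exact (he _ _ hx).symm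

theorem HasJordanType.sum_sub_le_finrank_range [Fintype ι] {N : End K W} {l : ι → ℕ}
    (h : HasJordanType N l) (r : ℕ) : ∑ i, (l i - r) ≤ finrank K (LinearMap.range (N ^ r)) := by
  obtain ⟨b, w, -, hb⟩ := h
  let shift (x : Σ i, Fin (l i - r)) : Σ i, Fin (l i) := ⟨x.1, r + x.2, by omega⟩
  have hshift : Function.Injective shift := by
    rintro ⟨i, s⟩ ⟨j, t⟩ h
    obtain ⟨rfl, h⟩ := Sigma.mk.inj_iff.1 h
    have hst := congrArg Fin.val (eq_of_heq h)
    simp only [Nat.add_left_cancel_iff] at hst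
    rw [Fin.ext hst]
  have hmem (x) : b (shift x) ∈ LinearMap.range (N ^ r) :=
    ⟨(N ^ (x.2 : ℕ)) (w x.1), by rw [hb, ← End.mul_apply, ← pow_add]⟩
  have hli : LinearIndependent K fun x => (⟨b (shift x), hmem x⟩ : LinearMap.range (N ^ r)) :=
    LinearIndependent.of_comp (LinearMap.range (N ^ r)).subtype (b.linearIndependent.comp _ hshift)
  have := Module.Finite.of_basis b
  simpa using hli.fintype_card_le_finrank

theorem HasJordanType.le_of_pow_eq_zero {N : End K W} {l : ι → ℕ} (h : HasJordanType N l) {q : ℕ}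
    (hN : N ^ q = 0) (i : ι) : l i ≤ q := by
  obtain ⟨b, w, -, hb⟩ := h
  by_contra! hlt
  exact b.ne_zero ⟨i, q, hlt⟩ (by rw [hb, hN, LinearMap.zero_apply])

/-- The endomorphism `N` is a single nilpotent Jordan block: `b` is the basis
`v, N v, …, N ^ (d - 1) v`. The vector `v` is a separate argument because `b` has no first element
when `d = 0`. -/
structure IsJordanBasis (N : End K W) {d : ℕ} (b : Basis (Fin d) K W) (v : W) : Prop where
  pow_eq_zero : N ^ d = 0
  basis_apply : ∀ t, b t = (N ^ (t : ℕ)) v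

variable {U : ι → Type*} [∀ i, AddCommGroup (U i)] [∀ i, Module K (U i)]

theorem dfinsuppBasis_apply [DecidableEq ι] {η : ι → Type*} (b : ∀ i, Basis (η i) K (U i))
    (x : Σ i, η i) : DFinsupp.basis b x = DFinsupp.single x.1 (b x.1 x.2) := by
  classical
  have hrepr : sigmaFinsuppEquivDFinsupp (Finsupp.single x (1 : K)) =
      DFinsupp.mapRange (fun i => (b i).repr) (by simp) (DFinsupp.single x.1 (b x.1 x.2)) := by
    simp
  refine (DFinsupp.basis b).apply_eq_iff.2 (Equiv.symm_apply_eq _ |>.2 hrepr.symm)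

theorem hasJordanType_lmap {N : ∀ i, End K (U i)} {l : ι → ℕ} {b : ∀ i, Basis (Fin (l i)) K (U i)}
    {v : ∀ i, U i} (h : ∀ i, IsJordanBasis (N i) (b i) (v i)) :
    HasJordanType (DirectSum.lmap N : End K (⨁ i, U i)) l := by
  classical
  have hpow (r : ℕ) (i : ι) (x : U i) : ((DirectSum.lmap N : End K (⨁ i, U i)) ^ r)
      (DirectSum.lof K ι U i x) = DirectSum.lof K ι U i ((N i ^ r) x) :=
    LinearMap.congr_fun (End.commute_pow_left_of_commute (f := DirectSum.lof K ι U i)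
      (LinearMap.ext fun x => DirectSum.lmap_lof N i x) r) x
  refine ⟨DFinsupp.basis b, fun i => DirectSum.lof K ι U i (v i), fun i => ?_, fun x => ?_⟩
  · rw [hpow, (h i).pow_eq_zero, LinearMap.zero_apply, map_zero]
  · rw [hpow, ← (h x.1).basis_apply]
    exact dfinsuppBasis_apply b x

theorem directSum_lmap_sub_one (A : ∀ i, End K (U i)) :
    DirectSum.lmap (fun i => A i - 1) = (DirectSum.lmap A - 1 : End K (⨁ i, U i)) := by
  classical
  ext
  simp

end JordanType

section CommutingNilpotents

open Finset

variable {K R : Type*} [CommRing K] [Ring R] [Algebra K R] {x y : R} {m n c : ℕ}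

theorem add_pow_mul_pow_eq_sum (h : Commute x y) (hx : x ^ m = 0) (hy : y ^ n = 0) (hcm : c ≤ m)
    (hcn : c ≤ n) (i : Fin c) : (x + y) ^ (m - c + (n - c) + i) * x ^ (c - 1 - i) =
      ∑ s, (binomialMatrix (m - c) (n - c) c i s : K) • (x ^ (m - 1 - s) * y ^ (n - c + s)) := by
  obtain ⟨a, rfl⟩ := Nat.exists_eq_add_of_le' hcm
  obtain ⟨b, rfl⟩ := Nat.exists_eq_add_of_le' hcn
  simp only [Nat.add_sub_cancel]
  have hterm : ∀ j ∈ range (a + b + i + 1), x ^ (c - 1 - i) * (y ^ j * x ^ (a + b + i - j)) =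
      x ^ (a + b + c - 1 - j) * y ^ j := by
    intro j hj
    have hj := mem_range.1 hj
    rw [← (h.pow_pow _ j).eq, ← mul_assoc, ← pow_add]
    congr 2
    omega
  have hcomm : Commute (x + y) x := (Commute.refl x).add_left h.symm
  calc (x + y) ^ (a + b + i) * x ^ (c - 1 - i)
      = ∑ j ∈ range (a + b + i + 1),
          (a + b + i).choose j • (x ^ (a + b + c - 1 - j) * y ^ j) := by
        rw [(hcomm.pow_pow _ _).eq, add_comm x y, h.symm.add_pow, mul_sum]
        refine sum_congr rfl fun j hj => ?_
        rw [← mul_assoc, hterm j hj, nsmul_eq_mul, Nat.cast_comm]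
    _ = ∑ j ∈ Ico b (b + c), (a + b + i).choose j • (x ^ (a + b + c - 1 - j) * y ^ j) := by
        refine sum_congr_of_eq_on_inter (fun j _ hj => ?_) (fun j _ hj => ?_) fun _ _ _ => rfl
        · rcases lt_or_ge j b with hjb | hjb
          · rw [pow_eq_zero_of_le (by omega) hx, zero_mul, smul_zero]
          · rw [pow_eq_zero_of_le (by simp_all) hy, mul_zero, smul_zero]
        · rw [Nat.choose_eq_zero_of_lt (by simpa using hj), zero_smul]
    _ = ∑ s : Fin c, (binomialMatrix a b c i s : K) • (x ^ (a + c - 1 - s) * y ^ (b + s)) := by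
        rw [sum_Ico_eq_sum_range, Nat.add_sub_cancel_left, sum_range]
        refine sum_congr rfl fun s _ => ?_
        rw [binomialMatrix, Matrix.of_apply, Int.cast_natCast, Nat.cast_smul_eq_nsmul,
          show a + b + c - 1 - (b + s) = a + c - 1 - s by omega]

theorem exists_add_pow_mul_eq (h : Commute x y) (hx : x ^ m = 0) (hy : y ^ n = 0) (hcm : c ≤ m)
    (hcn : c ≤ n) (hdet : IsUnit ((binomialMatrix (m - c) (n - c) c).det : K)) (v : Fin c → K) :
    ∃ u, (x + y) ^ (m - c + (n - c)) * u = ∑ s, v s • (x ^ (m - 1 - s) * y ^ (n - c + s)) := by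
  let M : Matrix (Fin c) (Fin c) K := (binomialMatrix (m - c) (n - c) c).map Int.cast
  have hM : IsUnit M.det := by rwa [Int.cast_det] at hdet
  obtain ⟨f, rfl⟩ : ∃ f, Matrix.vecMul f M = v :=
    ⟨Matrix.vecMul v M⁻¹, by rw [Matrix.vecMul_vecMul, Matrix.nonsing_inv_mul M hM,
      Matrix.vecMul_one]⟩
  have hrow (i : Fin c) : (x + y) ^ (m - c + (n - c)) * ((x + y) ^ (i : ℕ) * x ^ (c - 1 - i : ℕ)) =
      ∑ s, M i s • (x ^ (m - 1 - s) * y ^ (n - c + s)) := by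
    rw [← mul_assoc, ← pow_add]
    exact add_pow_mul_pow_eq_sum h hx hy hcm hcn i
  refine ⟨∑ i : Fin c, f i • ((x + y) ^ (i : ℕ) * x ^ (c - 1 - i : ℕ)), ?_⟩
  simp only [mul_sum, mul_smul_comm, hrow, smul_sum, smul_smul, Matrix.vecMul, dotProduct,
    sum_smul]
  exact sum_comm

theorem add_mul_alternating_sum_eq_zero (h : Commute x y) (hx : x ^ m = 0) (hy : y ^ n = 0)
    (hcm : c ≤ m) (hcn : c ≤ n) :
    (x + y) * ∑ s : Fin c, (-1 : K) ^ (c - 1 - s : ℕ) •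
      (x ^ (m - 1 - s) * y ^ (n - c + s)) = 0 := by
  obtain ⟨a, rfl⟩ := Nat.exists_eq_add_of_le' hcm
  obtain ⟨b, rfl⟩ := Nat.exists_eq_add_of_le' hcn
  simp only [Nat.add_sub_cancel]
  have hfactor : ∑ s : Fin c, (-1 : K) ^ (c - 1 - s : ℕ) • (x ^ (a + c - 1 - s) * y ^ (b + s)) =
      (∑ s ∈ range c, y ^ s * (-x) ^ (c - 1 - s)) * (x ^ a * y ^ b) := by
    rw [sum_range, sum_mul]
    refine sum_congr rfl fun s _ => ?_
    have hxs : x ^ (c - 1 - s : ℕ) * x ^ a = x ^ (a + c - 1 - s) := by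
      rw [← pow_add]
      congr 1
      omega
    rw [← neg_one_smul K x, smul_pow, mul_smul_comm, smul_mul_assoc, mul_assoc,
      ← mul_assoc (x ^ _), hxs, ← mul_assoc, (h.symm.pow_pow _ _).eq, mul_assoc, ← pow_add,
      add_comm b]
  have hgeom := h.symm.neg_right.mul_geom_sum₂ c
  rw [sub_neg_eq_add, add_comm y x] at hgeom
  have hxc : x ^ c * (x ^ a * y ^ b) = 0 := by
    rw [← mul_assoc, ← pow_add, add_comm c, hx, zero_mul]
  have hyc : y ^ c * (x ^ a * y ^ b) = 0 := by
    rw [(h.pow_pow a b).eq, ← mul_assoc, ← pow_add, add_comm c, hy, zero_mul]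
  rw [hfactor, ← mul_assoc, hgeom, sub_mul, neg_pow, mul_assoc, hxc, hyc, mul_zero, sub_zero]

end CommutingNilpotents

section MonomialBasis

open Module

variable {K W : Type*} [Field K] [AddCommGroup W] [Module K W] {X Y : End K W} {m n : ℕ} {ξ : W}
  {B : Basis (Fin m × Fin n) K W}

/-- `X` and `Y` commute and the monomials `X ^ i * Y ^ j`, for `i < m` and `j < n`, applied to `ξ`
form the basis `B`. This models the tensor product of Jordan blocks of sizes `m` and `n`, on which
`X + Y` is the nilpotent part of the diagonal action. -/
structure IsMonomialBasis (X Y : End K W) (B : Basis (Fin m × Fin n) K W) (ξ : W) : Prop where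
  commute : Commute X Y
  pow_left : X ^ m = 0
  pow_right : Y ^ n = 0
  basis_apply : ∀ x, B x = (X ^ (x.1 : ℕ) * Y ^ (x.2 : ℕ)) ξ

theorem sum_standard_parts (hmn : m ≤ n) : ∑ i : Fin m, (m + n - 1 - 2 * (i : ℕ)) = m * n := by
  rw [Fin.sum_univ_eq_sum_range fun i => m + n - 1 - 2 * i]
  obtain ⟨d, rfl⟩ := Nat.exists_eq_add_of_le hmn
  clear hmn
  induction m with
  | zero => simp
  | succ m ih =>
    have hshift : ∀ i, m + 1 + (m + 1 + d) - 1 - 2 * (i + 1) = m + (m + d) - 1 - 2 * i := by omega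
    simp only [Finset.sum_range_succ', hshift, ih]
    rw [show m + 1 + (m + 1 + d) - 1 - 2 * 0 = 2 * m + d + 1 by omega]
    ring

theorem sq_le_sum_sub (hmn : m ≤ n) {c : ℕ} (hcm : c ≤ m) :
    c ^ 2 ≤ ∑ i : Fin m, (m + n - 1 - 2 * (i : ℕ) - (m - c + (n - c))) := by
  rw [sq, ← sum_standard_parts le_rfl, Fin.sum_univ_eq_sum_range (fun i => c + c - 1 - 2 * i),
    Fin.sum_univ_eq_sum_range fun i => m + n - 1 - 2 * i - (m - c + (n - c))]
  have hterm (i : ℕ) : c + c - 1 - 2 * i = m + n - 1 - 2 * i - (m - c + (n - c)) := by omega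
  simp only [hterm]
  exact Finset.sum_le_sum_of_subset (Finset.range_subset_range.2 hcm)

theorem card_sigma_fin_add_card_sigma_fin (c : ℕ) : Fintype.card (Σ k : Fin c, Fin (k + 1)) +
    Fintype.card (Σ k : Fin (c - 1), Fin (k + 1)) = c ^ 2 := by
  simp only [Fintype.card_sigma, Fintype.card_fin, Fin.sum_univ_eq_sum_range fun k => k + 1]
  induction c with
  | zero => rfl
  | succ c ih =>
    rcases c with - | c
    · rfl
    · simp only [Nat.add_sub_cancel, Finset.sum_range_succ] at ih ⊢
      linarith

/-- The vectors `(X + Y) ^ (r + t) X ^ (k - t) ξ` of degrees `r + k` for `k < c`. -/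
def sumPowVectors (X Y : End K W) (r c : ℕ) (ξ : W) (x : Σ k : Fin c, Fin (k + 1)) : W :=
  ((X + Y) ^ (r + x.2) * X ^ (x.1 - x.2 : ℕ)) ξ

/-- The monomials `X ^ (m - 1 - t) Y ^ (n - 1 - (k - t)) ξ` of codegrees `k < c`, that is, `k` below
the top degree `m + n - 2`. -/
def topMonomials (X Y : End K W) (m n c : ℕ) (ξ : W) (x : Σ k : Fin c, Fin (k + 1)) : W :=
  (X ^ (m - 1 - x.2) * Y ^ (n - 1 - (x.1 - x.2))) ξ

namespace IsMonomialBasis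

theorem coord_alternating_sum (h : IsMonomialBasis X Y B ξ) (hmn : m ≤ n) (i j : Fin m) :
    B.coord (j.rev, ⟨n - 1, by have := j.pos; omega⟩) ((∑ s : Fin (i + 1), (-1 : K) ^ (i - s : ℕ) •
      (X ^ (m - 1 - s) * Y ^ (n - (i + 1) + s))) ξ) = if i = j then 1 else 0 := by
  have hcoord (s : Fin (i + 1)) : B.coord (j.rev, ⟨n - 1, by have := j.pos; omega⟩)
      ((X ^ (m - 1 - s) * Y ^ (n - (i + 1) + s)) ξ) =
        if s = Fin.last i ∧ i = j then 1 else 0 := by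
    rw [← h.basis_apply (⟨m - 1 - s, by omega⟩, ⟨n - (i + 1) + s, by omega⟩), Basis.coord_apply,
      Basis.repr_self, Finsupp.single_apply]
    congr 1
    simp only [Prod.mk.injEq, Fin.ext_iff, Fin.val_rev, Fin.val_last, eq_iff_iff]
    omega
  simp only [LinearMap.sum_apply, LinearMap.smul_apply, map_sum, map_smul, hcoord]
  rw [Finset.sum_eq_single (Fin.last i) (by simp_all) (by simp)]
  simp

theorem hasJordanType_add (h : IsMonomialBasis X Y B ξ) (hmn : m ≤ n)
    (hdet : ∀ c ≤ m, ((binomialMatrix (m - c) (n - c) c).det : K) ≠ 0) :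
    HasJordanType (X + Y) fun i : Fin m => m + n - 1 - 2 * (i : ℕ) := by
  have := Module.Finite.of_basis B
  let z (i : Fin m) : W := (∑ s : Fin (i + 1), (-1 : K) ^ (i - s : ℕ) •
    (X ^ (m - 1 - s) * Y ^ (n - (i + 1) + s))) ξ
  have hz : LinearIndependent K z :=
    .of_pairwise_dual_eq_zero_one z _
      (fun j i hij => (h.coord_alternating_sum hmn i j).trans (if_neg hij.symm))
      (fun i => (h.coord_alternating_sum hmn i i).trans (if_pos rfl))
  have hkill (i : Fin m) : (X + Y) (z i) = 0 :=
    LinearMap.congr_fun (add_mul_alternating_sum_eq_zero h.commute h.pow_left h.pow_right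
      i.isLt (i.isLt.trans_le hmn)) ξ
  have hchain (i : Fin m) : ∃ w, ((X + Y) ^ (m + n - 1 - 2 * (i : ℕ) - 1)) w = z i := by
    obtain ⟨u, hu⟩ := exists_add_pow_mul_eq h.commute h.pow_left h.pow_right i.isLt
      (i.isLt.trans_le hmn) (hdet _ i.isLt).isUnit fun s => (-1) ^ (i - s : ℕ)
    refine ⟨u ξ, .trans ?_ (LinearMap.congr_fun hu ξ)⟩
    rw [End.mul_apply]
    congr 2
    omega
  choose w hw using hchain
  refine hasJordanType_of_linearIndependent (w := w) (fun i => ?_) (by simpa only [hw] using hz) ?_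
  · rw [show m + n - 1 - 2 * (i : ℕ) = m + n - 1 - 2 * (i : ℕ) - 1 + 1 by omega, pow_succ',
      End.mul_apply, hw, hkill]
  · rw [sum_standard_parts hmn, finrank_eq_card_basis B, Fintype.card_prod, Fintype.card_fin,
      Fintype.card_fin]

theorem pow_mul_apply_mem_span_topMonomials (h : IsMonomialBasis X Y B ξ) {c : ℕ} (t : ℕ) :
    ∀ u v, m + n ≤ t + u + v + c →
      ((X + Y) ^ t * (X ^ u * Y ^ v)) ξ ∈
        Submodule.span K (Set.range (topMonomials X Y m n (c - 1) ξ)) := by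
  induction t with
  | zero =>
    intro u v huv
    rcases le_or_gt m u with hu | hu
    · simp [pow_eq_zero_of_le hu h.pow_left]
    rcases le_or_gt n v with hv | hv
    · simp [pow_eq_zero_of_le hv h.pow_right]
    refine Submodule.subset_span
      ⟨⟨⟨m - 1 - u + (n - 1 - v), by omega⟩, ⟨m - 1 - u, by simp⟩⟩, ?_⟩
    rw [pow_zero, one_mul, topMonomials]
    congr 3 <;> dsimp only <;> omega
  | succ t ih =>
    intro u v huv
    have hsplit : (X + Y) ^ (t + 1) * (X ^ u * Y ^ v) =
        (X + Y) ^ t * (X ^ (u + 1) * Y ^ v) + (X + Y) ^ t * (X ^ u * Y ^ (v + 1)) := by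
      have hYX : Y * (X ^ u * Y ^ v) = X ^ u * Y ^ (v + 1) := by
        rw [← mul_assoc, (h.commute.symm.pow_right u).eq, mul_assoc, ← pow_succ']
      rw [pow_succ, mul_assoc, ← mul_add, add_mul, hYX, ← mul_assoc, ← pow_succ']
    rw [hsplit, LinearMap.add_apply]
    exact Submodule.add_mem _ (ih _ _ (by omega)) (ih _ _ (by omega))

theorem range_add_pow_le (h : IsMonomialBasis X Y B ξ) {c : ℕ} (hcm : c ≤ m) (hcn : c ≤ n) :
    LinearMap.range ((X + Y) ^ (m - c + (n - c))) ≤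
      Submodule.span K (Set.range (sumPowVectors X Y (m - c + (n - c)) c ξ)) ⊔
        Submodule.span K (Set.range (topMonomials X Y m n (c - 1) ξ)) := by
  set r := m - c + (n - c)
  have hmem (j : ℕ) : ∀ t i, ((X + Y) ^ (r + t) * (X ^ i * Y ^ j)) ξ ∈
      Submodule.span K (Set.range (sumPowVectors X Y r c ξ)) ⊔
        Submodule.span K (Set.range (topMonomials X Y m n (c - 1) ξ)) := by
    induction j with
    | zero =>
      intro t i
      rcases lt_or_ge (t + i) c with hti | hti
      · refine Submodule.mem_sup_left (Submodule.subset_span ⟨⟨⟨t + i, hti⟩, ⟨t, by simp⟩⟩, ?_⟩)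
        simp [sumPowVectors]
      · exact Submodule.mem_sup_right
          (h.pow_mul_apply_mem_span_topMonomials _ _ _ (by omega))
    | succ j ih =>
      intro t i
      have hsplit : (X + Y) ^ (r + t) * (X ^ i * Y ^ (j + 1)) =
          (X + Y) ^ (r + (t + 1)) * (X ^ i * Y ^ j) -
            (X + Y) ^ (r + t) * (X ^ (i + 1) * Y ^ j) := by
        have hYX : X ^ i * Y ^ (j + 1) = Y * (X ^ i * Y ^ j) := by
          rw [← mul_assoc, (h.commute.symm.pow_right i).eq, mul_assoc, ← pow_succ']
        rw [hYX, ← add_assoc, pow_succ, mul_assoc _ (X + Y), ← mul_sub, add_mul, pow_succ' X,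
          mul_assoc X, add_sub_cancel_left]
      rw [hsplit, LinearMap.sub_apply]
      exact Submodule.sub_mem _ (ih _ _) (ih _ _)
  rw [LinearMap.range_eq_map, ← B.span_eq, Submodule.map_span_le]
  rintro _ ⟨x, rfl⟩
  rw [h.basis_apply]
  exact hmem x.2 0 x.1

theorem linearIndependent_sumPowVectors (h : IsMonomialBasis X Y B ξ) (hmn : m ≤ n)
    (hJ : HasJordanType (X + Y) fun i : Fin m => m + n - 1 - 2 * (i : ℕ)) {c : ℕ} (hcm : c ≤ m) :
    LinearIndependent K (sumPowVectors X Y (m - c + (n - c)) c ξ) := by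
  have := Module.Finite.of_basis B
  have hrange := calc
    c ^ 2 ≤ ∑ i : Fin m, (m + n - 1 - 2 * (i : ℕ) - (m - c + (n - c))) := sq_le_sum_sub hmn hcm
    _ ≤ _ := hJ.sum_sub_le_finrank_range _
    _ ≤ _ := Submodule.finrank_mono (h.range_add_pow_le hcm (hcm.trans hmn))
    _ ≤ _ := Submodule.finrank_add_le_finrank_add_finrank _ _
  have htop := finrank_range_le_card (R := K) (topMonomials X Y m n (c - 1) ξ)
  have hcard := card_sigma_fin_add_card_sigma_fin c
  rw [linearIndependent_iff_card_le_finrank_span]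
  simp only [Set.finrank] at htop ⊢
  omega

theorem det_binomialMatrix_ne_zero (h : IsMonomialBasis X Y B ξ) (hmn : m ≤ n)
    (hJ : HasJordanType (X + Y) fun i : Fin m => m + n - 1 - 2 * (i : ℕ)) {c : ℕ} (hcm : c ≤ m) :
    ((binomialMatrix (m - c) (n - c) c).det : K) ≠ 0 := by
  let M : Matrix (Fin c) (Fin c) K := (binomialMatrix (m - c) (n - c) c).map Int.cast
  let e (s : Fin c) : W := (X ^ (m - 1 - s) * Y ^ (n - c + s)) ξ
  let diagonal (t : Fin c) : Σ k : Fin c, Fin (k + 1) :=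
    ⟨⟨c - 1, Nat.sub_lt t.pos one_pos⟩, ⟨t, by dsimp only; omega⟩⟩
  have hdiagonal : Function.Injective diagonal := fun s t hst => by
    simpa [diagonal, Fin.ext_iff] using hst
  have hrow : Fintype.linearCombination K e ∘ M.row =
      sumPowVectors X Y (m - c + (n - c)) c ξ ∘ diagonal := by
    funext t
    simpa [M, e, sumPowVectors, diagonal, Fintype.linearCombination_apply] using LinearMap.congr_fun
      (add_pow_mul_pow_eq_sum (K := K) h.commute h.pow_left h.pow_right hcm (hcm.trans hmn)
        t).symm ξ
  have hli : LinearIndependent K M.row := by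
    refine LinearIndependent.of_comp (Fintype.linearCombination K e) ?_
    rw [hrow]
    exact (h.linearIndependent_sumPowVectors hmn hJ hcm).comp _ hdiagonal
  have hdet := (Matrix.isUnit_iff_isUnit_det _).1 (Matrix.linearIndependent_rows_iff_isUnit.1 hli)
  rw [Int.cast_det]
  exact hdet.ne_zero

theorem hasJordanType_add_iff (h : IsMonomialBasis X Y B ξ) (hmn : m ≤ n) :
    HasJordanType (X + Y) (fun i : Fin m => m + n - 1 - 2 * (i : ℕ)) ↔
      ∀ c ≤ m, ((binomialMatrix (m - c) (n - c) c).det : K) ≠ 0 :=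
  ⟨fun hJ _ hcm => h.det_binomialMatrix_ne_zero hmn hJ hcm, h.hasJordanType_add hmn⟩

end IsMonomialBasis

end MonomialBasis

section JordanBlock

open Module LinearMap

variable {K W : Type*} [Field K] [AddCommGroup W] [Module K W]

theorem isCompl_range_ker_of_bijective_comp {E F : Type*} [AddCommGroup E] [Module K E]
    [AddCommGroup F] [Module K F] {f : E →ₗ[K] W} {g : W →ₗ[K] F}
    (h : Function.Bijective (g ∘ₗ f)) : IsCompl (range f) (ker g) := by
  refine ⟨Submodule.disjoint_def.2 ?_, codisjoint_iff.2 (eq_top_iff.2 fun x _ => ?_)⟩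
  · rintro _ ⟨y, rfl⟩ hy
    rw [h.1 (hy.trans (map_zero (g ∘ₗ f)).symm), map_zero]
  · obtain ⟨y, hy⟩ := h.2 (g x)
    refine Submodule.mem_sup.2 ⟨f y, ⟨y, rfl⟩, x - f y, ?_, add_sub_cancel _ _⟩
    rw [mem_ker, map_sub, ← hy, comp_apply, sub_self]

/-- The map sending a coefficient vector `g` to `∑ t, g t • N ^ t v`. -/
def chainCombination (N : End K W) (v : W) (k : ℕ) : (Fin k → K) →ₗ[K] W :=
  Fintype.linearCombination K fun t : Fin k => (N ^ (t : ℕ)) v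

/-- The map sending `x` to the vector of the values `φ (N ^ t x)`. -/
def chainEvaluation (N : End K W) (φ : Dual K W) (k : ℕ) : W →ₗ[K] (Fin k → K) :=
  LinearMap.pi fun t : Fin k => φ ∘ₗ (N ^ (t : ℕ))

variable {N : End K W} {k : ℕ}

theorem range_chainCombination_mem_invtSubmodule (hN : N ^ k = 0) (v : W) :
    range (chainCombination N v k) ∈ N.invtSubmodule := by
  rw [End.mem_invtSubmodule, chainCombination, Fintype.range_linearCombination,
    Submodule.span_le]
  rintro _ ⟨t, rfl⟩
  rw [SetLike.mem_coe, Submodule.mem_comap, ← End.mul_apply, ← pow_succ']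
  rcases (Nat.succ_le_of_lt t.2).eq_or_lt with ht | ht
  · rw [← Nat.succ_eq_add_one, ht, hN, LinearMap.zero_apply]
    exact Submodule.zero_mem _
  · exact Submodule.subset_span ⟨⟨t + 1, ht⟩, rfl⟩

theorem ker_chainEvaluation_mem_invtSubmodule (hN : N ^ k = 0) (φ : Dual K W) :
    ker (chainEvaluation N φ k) ∈ N.invtSubmodule := by
  intro x hx
  refine mem_ker.2 (funext fun t => ?_)
  change φ ((N ^ (t : ℕ)) (N x)) = 0
  rw [← End.mul_apply, ← pow_succ]
  rcases (Nat.succ_le_of_lt t.2).eq_or_lt with ht | ht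
  · rw [← Nat.succ_eq_add_one, ht, hN, LinearMap.zero_apply, map_zero]
  · exact congrFun (mem_ker.1 hx) ⟨t + 1, ht⟩

-- In the standard bases the matrix of the composite has `φ (N ^ (k - 1) v)` along the antidiagonal
-- and zeros below it.
theorem injective_chainEvaluation_comp_chainCombination (hN : N ^ k = 0) {φ : Dual K W} {v : W}
    (hφ : φ ((N ^ (k - 1)) v) ≠ 0) :
    Function.Injective (chainEvaluation N φ k ∘ₗ chainCombination N v k) := by
  refine (injective_iff_map_eq_zero _).2 fun g hg => funext fun ⟨t, ht⟩ => ?_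
  induction t using Nat.strong_induction_on with
  | _ t ih =>
    have hsum : ∑ s, g s • φ ((N ^ (k - 1 - t + s)) v) = 0 := by
      simpa [chainEvaluation, chainCombination, Fintype.linearCombination_apply, pow_add]
        using congrFun hg ⟨k - 1 - t, by omega⟩
    rw [Finset.sum_eq_single ⟨t, ht⟩ (fun s _ hst => ?_) (by simp), smul_eq_mul,
      Nat.sub_add_cancel (by omega : t ≤ k - 1)] at hsum
    · exact (mul_eq_zero.1 hsum).resolve_right hφ
    · rcases lt_or_gt_of_ne (Fin.val_ne_of_ne hst) with hlt | hlt
      · rw [ih s hlt s.2, Pi.zero_apply, zero_smul]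
      · simp only at hlt
        rw [show k - 1 - t + s = s - t - 1 + k by omega, pow_add, hN, mul_zero,
          LinearMap.zero_apply, map_zero, smul_zero]

theorem exists_isJordanBasis [FiniteDimensional K W] [Nontrivial W] (hN : IsNilpotent N)
    (h : ∀ A ∈ N.invtSubmodule, ∀ B ∈ N.invtSubmodule, IsCompl A B → A = ⊥ ∨ B = ⊥) :
    ∃ (b : Basis (Fin (finrank K W)) K W) (v : W), IsJordanBasis N b v := by
  set k := nilpotencyClass N
  have hNk : N ^ k = 0 := pow_nilpotencyClass hN
  obtain ⟨v, hv⟩ : ∃ v, (N ^ (k - 1)) v ≠ 0 := by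
    by_contra! hzero
    exact pow_pred_nilpotencyClass hN (LinearMap.ext hzero)
  obtain ⟨φ, hφ⟩ : ∃ φ : Dual K W, φ ((N ^ (k - 1)) v) ≠ 0 := by
    by_contra! hzero
    exact hv ((forall_dual_apply_eq_zero_iff K _).1 hzero)
  have hinj := injective_chainEvaluation_comp_chainCombination hNk hφ
  have hcompl := isCompl_range_ker_of_bijective_comp ⟨hinj, injective_iff_surjective.1 hinj⟩
  have hrange : range (chainCombination N v k) ≠ ⊥ := fun hbot =>
    hv ((Submodule.eq_bot_iff _).1 hbot _ ⟨Pi.single ⟨k - 1, Nat.sub_one_lt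
      (pos_nilpotencyClass_iff.2 hN).ne'⟩ 1, by simp [chainCombination]⟩)
  have hker := (h _ (range_chainCombination_mem_invtSubmodule hNk v) _
    (ker_chainEvaluation_mem_invtSubmodule hNk φ) hcompl).resolve_left hrange
  let e : (Fin k → K) ≃ₗ[K] W := .ofBijective (chainCombination N v k)
    ⟨Function.Injective.of_comp (f := chainEvaluation N φ k) hinj,
      range_eq_top.1 (by simpa [hker] using hcompl.sup_eq_top)⟩
  rw [← e.finrank_eq, finrank_fin_fun]
  exact ⟨(Pi.basisFun K (Fin k)).map e, v, hNk, fun t => by simp [e, chainCombination]⟩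

theorem sub_one_pow_char_pow_eq_zero {p : ℕ} [Fact p.Prime] [CharP K p] {A : End K W} {α : ℕ}
    (hA : A ^ p ^ α = 1) : (A - 1) ^ p ^ α = 0 := by
  have hfrobenius : (Polynomial.X - 1 : Polynomial K) ^ p ^ α = Polynomial.X ^ p ^ α - 1 := by
    rw [sub_pow_char_pow, one_pow]
  simpa [hA] using congrArg (Polynomial.aeval A) hfrobenius

end JordanBlock

section TensorProduct

open Module
open scoped TensorProduct

variable {K V W : Type*} [Field K] [AddCommGroup V] [Module K V] [AddCommGroup W] [Module K W]
  {m n : ℕ} {A : End K V} {B : End K W}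

theorem tensorMap_sub_one_eq_add : (TensorProduct.map A B - 1 : End K (V ⊗[K] W)) =
    TensorProduct.map (A - 1) 1 + TensorProduct.map A (B - 1) := by
  ext x y
  simp [TensorProduct.sub_tmul, TensorProduct.tmul_sub]

theorem exists_basis_tmul (bV : Basis (Fin m) K V) (bW : Basis (Fin n) K W) (hA : IsUnit A) :
    ∃ b : Basis (Fin m × Fin n) K (V ⊗[K] W),
      ∀ x, b x = (A ^ (x.2 : ℕ)) (bV x.1) ⊗ₜ[K] bW x.2 := by
  let e (j : Fin n) : V ≃ₗ[K] V := .ofBijective (A ^ (j : ℕ)) ((End.isUnit_iff _).1 (hA.pow j))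
  refine ⟨((Finsupp.basis fun j => bV.map (e j)).map
    (TensorProduct.equivFinsuppOfBasisRight bW).symm).reindex
      ((Equiv.sigmaEquivProd _ _).trans (.prodComm _ _)), fun x => ?_⟩
  simp [e]

theorem IsJordanBasis.exists_isMonomialBasis {bV : Basis (Fin m) K V} {bW : Basis (Fin n) K W}
    {v : V} {w : W} (hA : IsJordanBasis (A - 1) bV v) (hB : IsJordanBasis (B - 1) bW w) :
    ∃ b : Basis (Fin m × Fin n) K (V ⊗[K] W), IsMonomialBasis (TensorProduct.map (A - 1) 1)
      (TensorProduct.map A (B - 1)) b (v ⊗ₜ[K] w) := by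
  have hunit : IsUnit A := by
    simpa using IsNilpotent.isUnit_add_one ⟨m, hA.pow_eq_zero⟩
  have hcomm : Commute A (A - 1) := (Commute.refl A).sub_right (Commute.one_right A)
  obtain ⟨b, hb⟩ := exists_basis_tmul bV bW hunit
  refine ⟨b, ?_, ?_, ?_, fun x => ?_⟩
  · rw [Commute, SemiconjBy, ← TensorProduct.map_mul, ← TensorProduct.map_mul, hcomm.eq, one_mul,
      mul_one]
  · rw [TensorProduct.map_pow, hA.pow_eq_zero, TensorProduct.map_zero_left]
  · rw [TensorProduct.map_pow, hB.pow_eq_zero, TensorProduct.map_zero_right]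
  · rw [hb, hA.basis_apply, hB.basis_apply, ← End.mul_apply, (hcomm.pow_pow _ _).eq,
      TensorProduct.map_pow, TensorProduct.map_pow, ← TensorProduct.map_mul,
      TensorProduct.map_tmul, one_pow, one_mul]

end TensorProduct

section Representation

open Module
open scoped TensorProduct DirectSum

variable {K G : Type*} [Field K] [Group G] {g : G}

theorem IsIndecomposableRep.exists_isJordanBasis {W : Type*} [AddCommGroup W] [Module K W]
    [FiniteDimensional K W] {σ : Representation K G W} (hσ : IsIndecomposableRep σ)
    (hg : ∀ h, h ∈ Submonoid.powers g) (hN : IsNilpotent (σ g - 1)) :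
    ∃ (b : Basis (Fin (finrank K W)) K W) (v : W), IsJordanBasis (σ g - 1) b v := by
  have := hσ.1
  have hsub {A : Submodule K W} (hA : A ∈ End.invtSubmodule (σ g - 1)) (h : G) ⦃x : W⦄
      (hx : x ∈ A) : σ h x ∈ A := by
    have hAg : A ∈ End.invtSubmodule (σ g) := fun y hy => by
      simpa using A.add_mem (hA hy) hy
    obtain ⟨t, rfl⟩ := hg h
    rw [map_pow, End.coe_pow]
    exact Set.MapsTo.iterate hAg t hx
  exact _root_.exists_isJordanBasis hN fun A hA B hB =>
    hσ.2 ⟨A, hsub hA⟩ ⟨B, hsub hB⟩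

theorem nonempty_equiv_iff_of_generator {W W' : Type*} [AddCommGroup W] [Module K W]
    [AddCommGroup W'] [Module K W'] {σ : Representation K G W} {τ : Representation K G W'}
    (hg : ∀ h, h ∈ Submonoid.powers g) : Nonempty (σ.Equiv τ) ↔
      ∃ e : W ≃ₗ[K] W', ∀ v, (τ g - 1) (e v) = e ((σ g - 1) v) := by
  constructor
  · rintro ⟨φ⟩
    refine ⟨φ.toLinearEquiv, fun v => ?_⟩
    have hφ : τ g (φ.toLinearEquiv v) = φ.toLinearEquiv (σ g v) :=
      (LinearMap.congr_fun (φ.isIntertwining' g) v).symm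
    rw [LinearMap.sub_apply, LinearMap.sub_apply, hφ, map_sub, End.one_apply, End.one_apply]
  · rintro ⟨e, he⟩
    refine ⟨.mk e fun h => ?_⟩
    obtain ⟨t, rfl⟩ := hg h
    have hcomm : τ g ∘ₗ e.toLinearMap = e.toLinearMap ∘ₗ σ g :=
      LinearMap.ext fun v => by simpa using he v
    simpa using (End.commute_pow_left_of_commute hcomm t).symm

variable {V : ℕ → Type*} [∀ i, AddCommGroup (V i)] [∀ i, Module K (V i)]
  {ρ : ∀ i, Representation K G (V i)} {p α m n : ℕ} [hp : Fact p.Prime] [CharP K p]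

theorem IsIndecomposableSystem.exists_isJordanBasis (hρ : IsIndecomposableSystem ρ (p ^ α))
    (hg : ∀ h, h ∈ Submonoid.powers g) (hgα : g ^ p ^ α = 1) {i : ℕ} (hi : i ≤ p ^ α) :
    ∃ (b : Basis (Fin i) K (V i)) (v : V i), IsJordanBasis (ρ i g - 1) b v := by
  have := hρ.finiteDimensional i hi
  have hrank := hρ.finrank_eq i hi
  rcases i.eq_zero_or_pos with rfl | hpos
  · have := finrank_zero_iff.1 hrank
    exact ⟨Basis.empty _, 0, Subsingleton.elim _ _, fun t => t.elim0⟩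
  · have hblock := (hρ.indecomposable i hpos hi).exists_isJordanBasis hg
      ⟨p ^ α, sub_one_pow_char_pow_eq_zero (by rw [← map_pow, hgα, map_one])⟩
    rwa [hrank] at hblock

theorem hasJordanType_directSum (hρ : IsIndecomposableSystem ρ (p ^ α))
    (hg : ∀ h, h ∈ Submonoid.powers g) (hgα : g ^ p ^ α = 1) {ι : Type*} {l : ι → ℕ}
    (hl : ∀ i, l i ≤ p ^ α) :
    HasJordanType (Representation.directSum (fun i => ρ (l i)) g - 1) l := by
  choose b v hv using fun i => hρ.exists_isJordanBasis hg hgα (hl i)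
  have hlmap := hasJordanType_lmap hv
  rwa [directSum_lmap_sub_one] at hlmap

theorem nonempty_equiv_directSum_iff {ι W : Type*} [AddCommGroup W] [Module K W]
    {σ : Representation K G W} (hρ : IsIndecomposableSystem ρ (p ^ α))
    (hg : ∀ h, h ∈ Submonoid.powers g) (hgα : g ^ p ^ α = 1) {l : ι → ℕ} :
    (∀ i, l i ≤ p ^ α) ∧ Nonempty (σ.Equiv (Representation.directSum fun i => ρ (l i))) ↔
      HasJordanType (σ g - 1) l := by
  rw [nonempty_equiv_iff_of_generator hg]
  constructor
  · rintro ⟨hl, e, he⟩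
    exact (hasJordanType_directSum hρ hg hgα hl).congr e.symm fun v =>
      e.injective (by rw [← he, e.apply_symm_apply, e.apply_symm_apply])
  · intro hJ
    have hl := hJ.le_of_pow_eq_zero
      (sub_one_pow_char_pow_eq_zero (p := p) (α := α) (by rw [← map_pow, hgα, map_one]))
    exact ⟨hl, hJ.exists_linearEquiv (hasJordanType_directSum hρ hg hgα hl)⟩

theorem isStandardJordanPartition_iff_isJordanPartition (q : ℕ) (hmn : m ≤ n) :
    IsStandardJordanPartition ρ q m n ↔
      IsJordanPartition ρ q m n fun i => m + n - 1 - 2 * (i : ℕ) := by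
  constructor
  · rintro ⟨l, hJ, hl⟩
    obtain rfl : l = fun i : Fin m => m + n - 1 - 2 * (i : ℕ) :=
      funext fun i => by have := hl i; omega
    exact hJ
  · exact fun hJ => ⟨_, hJ, fun i => by omega⟩

theorem isStandardJordanPartition_iff_hasJordanType (hρ : IsIndecomposableSystem ρ (p ^ α))
    (hg : ∀ h, h ∈ Submonoid.powers g) (hgα : g ^ p ^ α = 1) (hmn : m ≤ n) :
    IsStandardJordanPartition ρ (p ^ α) m n ↔
      HasJordanType (TensorProduct.map (ρ m g) (ρ n g) - 1 : End K (V m ⊗[K] V n))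
        fun i : Fin m => m + n - 1 - 2 * (i : ℕ) := by
  rw [isStandardJordanPartition_iff_isJordanPartition _ hmn, ← Representation.tprod_apply,
    ← nonempty_equiv_directSum_iff hρ hg hgα]
  have hanti : Antitone fun i : Fin m => m + n - 1 - 2 * (i : ℕ) := fun i j hij => by
    dsimp only
    omega
  refine ⟨fun hJ => ⟨fun i => (hJ.2.1 i).2, hJ.2.2⟩, fun hJ => ⟨hanti, fun i => ⟨?_, hJ.1 i⟩, hJ.2⟩⟩
  dsimp only
  omega

theorem isStandardJordanPartition_iff_isStandardPair [IsCyclic G] (hG : Nat.card G = p ^ α)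
    (hρ : IsIndecomposableSystem ρ (p ^ α)) (hmn : m ≤ n) (hn : n ≤ p ^ α) :
    IsStandardJordanPartition ρ (p ^ α) m n ↔ IsStandardPair p m n := by
  have : Finite G := Nat.finite_of_card_ne_zero (hG ▸ pow_ne_zero _ hp.out.ne_zero)
  obtain ⟨g, hg⟩ := IsCyclic.exists_monoid_generator (α := G)
  have hgα : g ^ p ^ α = 1 := hG ▸ pow_card_eq_one'
  obtain ⟨_, _, hV⟩ := hρ.exists_isJordanBasis hg hgα (hmn.trans hn)
  obtain ⟨_, _, hW⟩ := hρ.exists_isJordanBasis hg hgα hn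
  obtain ⟨_, hB⟩ := hV.exists_isMonomialBasis hW
  rw [isStandardJordanPartition_iff_hasJordanType hρ hg hgα hmn, tensorMap_sub_one_eq_add,
    hB.hasJordanType_add_iff hmn, ← forall_not_dvd_det_binomialMatrix_iff hmn]
  simp only [Ne, CharP.intCast_eq_zero_iff K p]

end Representation

theorem proposition1
    {p : ℕ} (hp : p.Prime)
    {K : Type*} [Field K] [CharP K p]
    {G : Type*} [Group G] [IsCyclic G] {q α : ℕ} (hq : q = p ^ α) (hG : Nat.card G = q)
    {V : ℕ → Type*} [∀ i, AddCommGroup (V i)] [∀ i, Module K (V i)]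
    (ρ : ∀ i, Representation K G (V i)) (hρ : IsIndecomposableSystem ρ q)
    {m n : ℕ} (hm : 0 < m) (hmn : m ≤ n) (hnq : n ≤ q)
    {k a b c d : ℕ}
    (hn : n = b * p ^ k + d) (hb : 0 < b) (hbp : b < p) (hd : d < p ^ k)
    (hmac : m = a * p ^ k + c) (hap : a < p) (hc : c < p ^ k) :
    -- Case 1
    (m + n > p ^ (k + 1) →
      (IsStandardJordanPartition ρ q m n ↔
        m + n - p ^ (k + 1) = 1 ∧
          IsStandardJordanPartition ρ q (p ^ (k + 1) - n) (p ^ (k + 1) - m))) ∧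
    -- Case 2
    (m + n ≤ p ^ (k + 1) → c + d > p ^ k →
      (IsStandardJordanPartition ρ q m n ↔
        c + d - p ^ k = 1 ∧
          IsStandardJordanPartition ρ q
            ((a + b + 1) * p ^ k - n) ((a + b + 1) * p ^ k - m))) ∧
    -- Case 3
    (m + n ≤ p ^ (k + 1) → 1 ≤ c + d → c + d ≤ p ^ k → a > 0 →
      (IsStandardJordanPartition ρ q m n ↔
        IsStandardJordanPartition ρ q (min c d) (max c d) ∧
          |(c : ℤ) - (d : ℤ)| ≤ 1 ∧
          IsStandardJordanPartition ρ q ((a + b) * p ^ k - n) ((a + b) * p ^ k - m))) ∧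
    -- Case 4
    (m + n ≤ p ^ (k + 1) → 1 ≤ c + d → c + d ≤ p ^ k → a = 0 → d > 0 →
      (IsStandardJordanPartition ρ q m n ↔
        IsStandardJordanPartition ρ q m (b * p ^ k - d))) ∧
    -- Case 5
    (m + n ≤ p ^ (k + 1) → 1 ≤ c + d → c + d ≤ p ^ k → a = 0 → d = 0 →
      (IsStandardJordanPartition ρ q m n ↔ m = 1)) ∧
    -- Case 6
    (m + n ≤ p ^ (k + 1) → c = 0 → d = 0 →
      (IsStandardJordanPartition ρ q m n ↔ k = 0)) := by
  subst hq
  have := Fact.mk hp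
  have key {m n : ℕ} := isStandardJordanPartition_iff_isStandardPair (m := m) (n := n) hG hρ
  have hnp : n < p ^ (k + 1) := hn ▸ mul_pow_add_lt_pow_succ hbp hd
  have hQb : p ^ k ≤ b * p ^ k := Nat.le_mul_of_pos_left _ hb
  have hR : (a + b) * p ^ k = a * p ^ k + b * p ^ k := add_mul ..
  have hR' : (a + b + 1) * p ^ k = a * p ^ k + b * p ^ k + p ^ k := by ring
  subst hn hmac
  rw [key hmn hnq]
  refine ⟨fun h => ?_, fun h h1 => ?_, fun h h1 h2 h3 => ?_, ?_, ?_, ?_⟩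
  · rw [key (by omega) (by omega)]
    exact isStandardPair_iff_of_gt hp.two_le hm hmn hnp h
  · rw [key (by omega) (by omega)]
    exact isStandardPair_iff_of_residues_gt hp.two_le hc hd hmn hnp h h1
  · rw [key (by omega) (by omega), key (by omega) (by omega)]
    exact isStandardPair_iff_of_residues_le hp.two_le h3 hc hd hmn hnp h h1 h2
  · rintro - - h2 rfl h4
    rw [key (by omega) (by omega), zero_mul, zero_add]
    exact (isStandardPair_mul_pow_sub_iff hp.two_le hb hd hnp h2).symm
  · rintro - h1 - rfl rfl
    rw [zero_mul, zero_add]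
    exact isStandardPair_mul_pow_iff hp.two_le hc h1
  · rintro h rfl rfl
    exact isStandardPair_mul_pow_mul_pow_iff hp.two_le (Nat.pos_of_mul_pos_right hm)
      (Nat.le_of_mul_le_mul_right hmn hd) h
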